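/- Let $n\ge 1$, $B(z,r)=\{x\in\mathbf R^n:|x-z|<r\}$, $B^+(z,r)=B(z,r)\cap\{x_1>0\}$, $B_r=B(0,r)$, $B_r^+=B^+(0,r)$, $\Pi=\{x_1=0\}$. For $M\in\mathbf R$ let $P_1^+(M)$ be the set of functions $u$, continuous on $B_1^+\cup(\Pi\cap B_1)$ and continuously differentiable in $B_1^+$, such that 1. $\Delta u=\chi_{\Omega}$ in $B_1^+$ in the sense of distributions, where $\Omega=\Omega(u)=\{x\in B_1^+:|\nabla u(x)|\neq 0\}$; 2. $u=0$ on $\Pi\cap B_1$; 3. $|u|\le M$ in $B_1^+$. Let $\Gamma(u)=\{x\in B_1^+\cup(\Pi\cap B_1):|\nabla u(x)|=0\}\cap\partial\Omega$ (at points of $\Pi$ the gradient is the one-sided one, taken from $B_1^+\cup(\Pi\cap B_1)$), and let $P_1^+(0,M)$ be the set of $u\in P_1^+(M)$ with $0\in\Gamma(u)$. **Lemma (non-degeneracy).** There are constants $C\ge C'>0$ depending only on $n$ such that, for all $M$, all $u\in P_1^+(0,M)$ and all $x^0\in\overline{\Omega}\cap B_{1/2}$, the following holds. (i) If $u(x^0)\ge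 0$, and if, in the case $x^0\in\Pi$, moreover the one-sided derivative satisfies $\partial_{x_1}u(x^0)\ge 0$ (as it does at every contact point $x^0\in\Gamma(u)\cap\Pi$), then $$\sup_{B^+(x^0,r)}u\ \ge\ u(x^0)+C r^2\qquad\text{for all } 0<r<\operatorname{dist}(x^0,\partial B_1).$$ (ii) If $u(x^0)<0$, then $$\sup_{B^+(x^0,r)}u\ \ge\ u(x^0)+C' r^2\qquad\text{for all } r>0 \text{ with } B(x^0,r)\subset B_1^+ .$$ -/

import Mathlib

open Set MeasureTheory Metric
open scoped ContDiff InnerProductSpace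

noncomputable section

namespace HalfBallObstacle

/-- The Euclidean space `ℝⁿ`. The coordinate called `x₁` in the text is `x 0`. -/
abbrev E (n : ℕ) : Type := EuclideanSpace ℝ (Fin n)

variable {n : ℕ} [NeZero n]

/-- The open half ball `B⁺(z, r) = {x : x₁ > 0, |x - z| < r}`. -/
def halfBall (z : E n) (r : ℝ) : Set (E n) := {x | 0 < x 0} ∩ ball z r

/-- The flat part `Π_r = {x : x₁ = 0, |x| < r}` of the boundary of `B⁺_r`. -/
def flatBall (n : ℕ) [NeZero n] (r : ℝ) : Set (E n) := {x | x 0 = 0} ∩ ball 0 r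

/-- `Ω(u) = {|∇u| ≠ 0}`, for a function `u` given on `B⁺_r`. -/
def Omega (r : ℝ) (u : E n → ℝ) : Set (E n) := {x ∈ halfBall 0 r | gradient u x ≠ 0}

/-- `Δu = χ_D` in the open set `U` in the sense of distributions. -/
def LaplacianEqIndicator (U D : Set (E n)) (u : E n → ℝ) : Prop :=
  ∀ φ : E n → ℝ, ContDiff ℝ ∞ φ → HasCompactSupport φ → tsupport φ ⊆ U →
    ∫ x in U, u x * Laplacian.laplacian φ x = ∫ x in U, D.indicator 1 x * φ x

/-- The class `P⁺_r(M)` of local solutions. The function `u` is the representative which is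
continuous up to the flat boundary and has a classical continuous gradient in the open half ball,
so that `{|∇u| ≠ 0}` and the values of `u` make sense pointwise. Values of `u` outside
`B⁺_r ∪ Π_r` are irrelevant. -/
structure LocalSolution (r M : ℝ) (u : E n → ℝ) : Prop where
  contDiffOn : ContDiffOn ℝ 1 u (halfBall 0 r)
  continuousOn : ContinuousOn u (halfBall 0 r ∪ flatBall n r)
  laplacian_eq : LaplacianEqIndicator (halfBall 0 r) (Omega r u) u
  eq_zero : ∀ x ∈ flatBall n r, u x = 0
  bound : ∀ x ∈ halfBall 0 r, |u x| ≤ M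

/-- The free boundary `Γ(u) = {|∇u| = 0} ∩ ∂Ω(u)` in `B⁺_r ∪ Π_r`. At a point of `Π_r` the
gradient is the one-sided one, taken from within `B⁺_r ∪ Π_r`. -/
def freeBoundary (r : ℝ) (u : E n → ℝ) : Set (E n) :=
  {x ∈ halfBall 0 r ∪ flatBall n r |
    HasGradientWithinAt u 0 (halfBall 0 r ∪ flatBall n r) x} ∩ frontier (Omega r u)

/-- The class `P⁺_r(0, M)`: local solutions with `0 ∈ Γ(u)`. -/
def LocalSolutionAtZero (r M : ℝ) (u : E n → ℝ) : Prop :=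
  LocalSolution r M u ∧ (0 : E n) ∈ freeBoundary r u

/-- `c` is the one-sided derivative `∂u/∂x₁ (x)` in the inner normal direction `e₁`. -/
def HasNormalDeriv (u : E n → ℝ) (c : ℝ) (x : E n) : Prop :=
  HasDerivWithinAt (fun t : ℝ => u (x + t • EuclideanSpace.single (0 : Fin n) (1 : ℝ)))
    c (Ici 0) 0

end HalfBallObstacle

end

/-! ### Classical Laplacians, mollification, and the passage from distributional to viscosity
inequalities -/

section Viscosity

open Filter Topology Laplacian

variable {F : Type*} [NormedAddCommGroup F] [InnerProductSpace ℝ F]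

/-! Compare `u` with a paraboloid `c|x - x₁|²`, `2nc < 1`, centred at a point `x₁` of `Ω`, and
maximise the difference over a closed ball about `x₁` cut by `{x₁ ≥ 0}`. A maximum off both the
sphere and `Π` is impossible. In `Ω` the equation `Δu = 1` contradicts `2nc < 1`. Off `Ω` the
gradient of `u` vanishes, hence so does that of the paraboloid, which forces the centre, a point of
`Ω`. A maximum on `Π` is excluded as soon as `u(x₁) > -c|x - x₁|²` there. So the maximum lies on the
sphere, giving quadratic growth (`exists_growth`), and `x₁ → x⁰` carries it to `x⁰`
(`le_sSup_image`).

What remains is to find good centres near `x⁰`. If `x⁰` is off `Π`, continuity of `u` gives them. If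
`x⁰ ∈ Π`, centres with `u(x₁) ≥ 0` are needed. Were `u < 0` on all of `Ω` near `x⁰`, then `u ≤ 0`
nearby, so `u < 0` by the strong maximum principle, and Hopf's lemma would make the normal
derivative at `x⁰` negative.

As `u` is only `C¹`, the equation is used in the viscosity sense (`le_laplacian_of_isLocalMax`),
from which both maximum principles also follow. -/

theorem fderiv_fderiv_eq_deriv_deriv {f : F → ℝ} (hf : ContDiff ℝ 2 f) (x e : F) :
    fderiv ℝ (fun y => fderiv ℝ f y e) x e = deriv (deriv fun t : ℝ => f (x + t • e)) 0 := by
  have hl : ∀ t : ℝ, HasDerivAt (fun t : ℝ => x + t • e) e t := fun t => by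
    simpa using ((hasDerivAt_id t).smul_const e).const_add x
  have h1 : (deriv fun t : ℝ => f (x + t • e)) = fun t => fderiv ℝ f (x + t • e) e := by
    ext t
    have := ((hf.differentiable (by norm_num)) (x + t • e)).hasFDerivAt.comp_hasDerivAt t (hl t)
    exact this.deriv
  have hd : Differentiable ℝ fun y => fderiv ℝ f y e :=
    ((hf.fderiv_right (m := 1) (by norm_num)).clm_apply contDiff_const).differentiable
      (by norm_num)
  rw [h1]
  have := (hd (x + (0 : ℝ) • e)).hasFDerivAt.comp_hasDerivAt 0 (hl 0)
  have h2 := this.deriv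
  simp only [zero_smul, add_zero] at h2
  exact h2.symm

variable [FiniteDimensional ℝ F]

/-- The distance from a point of `s` to the complement is attained on the frontier. -/
theorem ball_subset_of_lt_infDist_frontier {x : F} {r : ℝ} {s : Set F} (hx : x ∈ s)
    (h : r < infDist x (frontier s)) : ball x r ⊆ s := by
  by_contra hns
  obtain ⟨y, hy, hys⟩ := not_subset.1 hns
  obtain ⟨w, hwf, hw⟩ := exists_mem_frontier_infDist_compl_eq_dist hx
    fun huniv => hys (huniv ▸ mem_univ y)
  have h1 := infDist_le_dist_of_mem (x := x) hwf
  have h2 := infDist_le_dist_of_mem (x := x) (mem_compl hys)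
  rw [dist_comm x y] at h2
  linarith [mem_ball.1 hy]

theorem laplacian_eq_sum_fderiv {ι : Type*} [Fintype ι] (b : OrthonormalBasis ι ℝ F) {f : F → ℝ}
    (hf : ContDiff ℝ 2 f) (x : F) :
    Δ f x = ∑ i, fderiv ℝ (fun y => fderiv ℝ f y (b i)) x (b i) := by
  rw [InnerProductSpace.laplacian_eq_iteratedFDeriv_orthonormalBasis f b]
  refine Finset.sum_congr rfl fun i _ => ?_
  have h : DifferentiableAt ℝ (fderiv ℝ f) x :=
    ((hf.fderiv_right (m := 1) (by norm_num)).differentiable (by norm_num)).differentiableAt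
  rw [iteratedFDeriv_two_apply, fderiv_clm_apply h (differentiableAt_const _)]
  simp

theorem laplacian_eq_sum_deriv_deriv {ι : Type*} [Fintype ι] (b : OrthonormalBasis ι ℝ F)
    {f : F → ℝ} (hf : ContDiff ℝ 2 f) (x : F) :
    Δ f x = ∑ i, deriv (deriv fun t : ℝ => f (x + t • b i)) 0 := by
  rw [laplacian_eq_sum_fderiv b hf]
  exact Finset.sum_congr rfl fun i _ => fderiv_fderiv_eq_deriv_deriv hf x (b i)

theorem deriv_deriv_nonpos_of_isLocalMax {g : ℝ → ℝ} {t : ℝ} (hg : ContinuousAt g t)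
    (h : IsLocalMax g t) : deriv (deriv g) t ≤ 0 := by
  by_contra! hpos
  -- A positive second derivative would make `t` a local minimum too, so `g` would be locally
  -- constant.
  have hmin := isLocalMin_of_deriv_deriv_pos hpos h.deriv_eq_zero hg
  have hc : g =ᶠ[𝓝 t] fun _ => g t := by
    filter_upwards [h, hmin] with s h1 h2 using le_antisymm h1 h2
  have h2 := hc.deriv.deriv_eq
  simp at h2
  exact hpos.ne' h2

theorem laplacian_nonpos_of_isLocalMax {f : F → ℝ} (hf : ContDiff ℝ 2 f) {x : F}
    (h : IsLocalMax f x) : Δ f x ≤ 0 := by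
  rw [laplacian_eq_sum_deriv_deriv (stdOrthonormalBasis ℝ F) hf]
  refine Finset.sum_nonpos fun i _ => ?_
  have hc : Continuous fun t : ℝ => x + t • stdOrthonormalBasis ℝ F i := by fun_prop
  refine deriv_deriv_nonpos_of_isLocalMax (hf.continuous.comp hc).continuousAt ?_
  have ht : Tendsto (fun t : ℝ => x + t • stdOrthonormalBasis ℝ F i) (𝓝 0) (𝓝 x) := by
    simpa using hc.tendsto 0
  have := ht.eventually h
  simpa [IsLocalMax, IsMaxFilter] using this

theorem continuous_laplacian {f : F → ℝ} (hf : ContDiff ℝ 2 f) : Continuous (Δ f) := by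
  have : Δ f = fun x => ∑ i, fderiv ℝ (fun y => fderiv ℝ f y (stdOrthonormalBasis ℝ F i)) x
      (stdOrthonormalBasis ℝ F i) := funext fun x => laplacian_eq_sum_fderiv _ hf x
  rw [this]
  refine continuous_finsetSum _ fun i _ => ?_
  have h : ContDiff ℝ 1 fun y => fderiv ℝ f y (stdOrthonormalBasis ℝ F i) :=
    (hf.fderiv_right (m := 1) (by norm_num)).clm_apply contDiff_const
  exact (h.continuous_fderiv (by norm_num)).clm_apply continuous_const

theorem laplacian_norm_sub_sq (z x : F) :
    Δ (fun y : F => ‖y - z‖ ^ 2) x = 2 * Module.finrank ℝ F := by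
  have hf : ContDiff ℝ 2 fun y : F => ‖y - z‖ ^ 2 := (contDiff_id.sub contDiff_const).norm_sq ℝ
  rw [laplacian_eq_sum_deriv_deriv (stdOrthonormalBasis ℝ F) hf]
  have : ∀ i, deriv (deriv fun t : ℝ => ‖x + t • stdOrthonormalBasis ℝ F i - z‖ ^ 2) 0 = 2 := by
    intro i
    set e := stdOrthonormalBasis ℝ F i
    have he : ‖e‖ = 1 := by simp [e]
    have h1 : (fun t : ℝ => ‖x + t • e - z‖ ^ 2) =
        fun t => ‖x - z‖ ^ 2 + 2 * inner ℝ (x - z) e * t + t ^ 2 := by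
      ext t
      rw [show x + t • e - z = (x - z) + t • e by abel, norm_add_sq_real, norm_smul, he,
        inner_smul_right, mul_one, Real.norm_eq_abs, sq_abs]
      ring
    have h2 : deriv (fun t : ℝ => ‖x - z‖ ^ 2 + 2 * inner ℝ (x - z) e * t + t ^ 2) =
        fun t => 2 * inner ℝ (x - z) e + 2 * t := by
      ext t
      have : HasDerivAt (fun t : ℝ => ‖x - z‖ ^ 2 + 2 * inner ℝ (x - z) e * t + t ^ 2)
          (2 * inner ℝ (x - z) e * 1 + 2 * t) t := by
        have := (((hasDerivAt_id t).const_mul (2 * inner ℝ (x - z) e)).const_add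
          (‖x - z‖ ^ 2)).fun_add (hasDerivAt_pow 2 t)
        simpa using this
      simpa using this.deriv
    rw [h1, h2]
    simp
  simp [this, mul_comm]

theorem laplacian_comp_const_sub {f : F → ℝ} (hf : ContDiff ℝ 2 f) (a x : F) :
    Δ (fun t => f (a - t)) x = Δ f (a - x) := by
  have hg : ContDiff ℝ 2 fun t => f (a - t) := hf.comp (contDiff_const.sub contDiff_id)
  set b := stdOrthonormalBasis ℝ F
  rw [laplacian_eq_sum_deriv_deriv b hg, laplacian_eq_sum_deriv_deriv b hf]
  refine Finset.sum_congr rfl fun i _ => ?_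
  have h : (fun t : ℝ => f (a - (x + t • b i))) =
      fun t : ℝ => (fun s : ℝ => f (a - x + s • b i)) (-t) := by
    ext t
    congr 1
    rw [neg_smul]
    abel
  rw [h]
  have h1 : deriv (fun t : ℝ => (fun s : ℝ => f (a - x + s • b i)) (-t)) =
      fun t => -(deriv fun s : ℝ => f (a - x + s • b i)) (-t) := by
    ext t
    exact deriv_comp_neg (fun s : ℝ => f (a - x + s • b i)) t
  rw [h1, deriv.fun_neg, deriv_comp_neg]
  simp

theorem support_laplacian_subset (φ : F → ℝ) :
    Function.support (Δ φ) ⊆ tsupport φ := by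
  intro x hx
  by_contra hxt
  have h0 : φ =ᶠ[𝓝 x] fun _ => (0 : ℝ) := notMem_tsupport_iff_eventuallyEq.1 hxt
  refine hx ?_
  rw [(InnerProductSpace.laplacian_congr_nhds h0).eq_of_nhds]
  simp

variable [MeasurableSpace F] [BorelSpace F]

open scoped Convolution in
theorem fderiv_convolution_left_apply {f g : F → ℝ} (hcf : HasCompactSupport f)
    (hf : ContDiff ℝ 1 f) (hg : LocallyIntegrable g) (x e : F) :
    fderiv ℝ (f ⋆[ContinuousLinearMap.lsmul ℝ ℝ] g) x e =
      ((fun y => fderiv ℝ f y e) ⋆[ContinuousLinearMap.lsmul ℝ ℝ] g) x := by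
  rw [(hcf.hasFDerivAt_convolution_left _ hf hg x).fderiv]
  have hc : HasCompactSupport (fderiv ℝ f) := hcf.fderiv ℝ
  have hex : ConvolutionExistsAt (fderiv ℝ f) g x
      ((ContinuousLinearMap.lsmul ℝ ℝ : ℝ →L[ℝ] ℝ →L[ℝ] ℝ).precompL F) volume :=
    (hc.convolutionExists_left _ (hf.continuous_fderiv (by norm_num)) hg) x
  rw [convolution_def, ContinuousLinearMap.integral_apply hex, convolution_def]
  rfl

-- All derivatives fall on the smooth factor, so `g` need only be locally integrable.
open scoped Convolution in
theorem laplacian_convolution_left {f g : F → ℝ} (hcf : HasCompactSupport f)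
    (hf : ContDiff ℝ ∞ f) (hg : LocallyIntegrable g) (x : F) :
    Δ (f ⋆[ContinuousLinearMap.lsmul ℝ ℝ] g) x = ∫ t, Δ f (x - t) * g t := by
  have hf2 : ContDiff ℝ 2 f := contDiff_infty.1 hf 2
  have hconv : ContDiff ℝ 2 (f ⋆[ContinuousLinearMap.lsmul ℝ ℝ] g) :=
    hcf.contDiff_convolution_left (n := 2) _ hf2 hg
  set b := stdOrthonormalBasis ℝ F
  have hd : ∀ e, ContDiff ℝ 1 fun y => fderiv ℝ f y e := fun e =>
    (hf2.fderiv_right (m := 1) (by norm_num)).clm_apply contDiff_const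
  have hcd : ∀ e, HasCompactSupport fun y => fderiv ℝ f y e := fun e => hcf.fderiv_apply ℝ e
  have hi : ∀ i, Integrable fun t =>
      fderiv ℝ (fun y => fderiv ℝ f y (b i)) (x - t) (b i) * g t := fun i => by
    have hex : ConvolutionExistsAt g (fun y => fderiv ℝ (fun y => fderiv ℝ f y (b i)) y (b i)) x
        (ContinuousLinearMap.lsmul ℝ ℝ) volume :=
      (((hcd (b i)).fderiv_apply ℝ (b i)).convolutionExists_right _ hg
        (((hd (b i)).continuous_fderiv (by norm_num)).clm_apply continuous_const)) x
    have h2 : Integrable fun t => g t *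
      fderiv ℝ (fun y => fderiv ℝ f y (b i)) (x - t) (b i) := hex
    simpa only [mul_comm] using h2
  rw [laplacian_eq_sum_fderiv b hconv]
  simp_rw [laplacian_eq_sum_fderiv b hf2, Finset.sum_mul]
  rw [integral_finsetSum _ fun i _ => hi i]
  refine Finset.sum_congr rfl fun i _ => ?_
  have h1 : (fun y => fderiv ℝ (f ⋆[ContinuousLinearMap.lsmul ℝ ℝ] g) y (b i)) =
      (fun y => fderiv ℝ f y (b i)) ⋆[ContinuousLinearMap.lsmul ℝ ℝ] g :=
    funext fun y => fderiv_convolution_left_apply hcf (contDiff_infty.1 hf 1) hg y _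
  rw [h1, fderiv_convolution_left_apply (hcd _) (hd _) hg, convolution_eq_swap]
  rfl

/-- `Δu ≥ m` in `V` in the sense of distributions. -/
def LaplacianGE (V : Set F) (m : ℝ) (u : F → ℝ) : Prop :=
  ∀ φ : F → ℝ, ContDiff ℝ ∞ φ → HasCompactSupport φ → tsupport φ ⊆ V → (∀ x, 0 ≤ φ x) →
    m * ∫ x, φ x ≤ ∫ x, u x * Δ φ x

theorem LaplacianGE.mono {V W : Set F} {m : ℝ} {u : F → ℝ} (h : LaplacianGE V m u) (hW : W ⊆ V) :
    LaplacianGE W m u :=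
  fun φ h1 h2 h3 h4 => h φ h1 h2 (h3.trans hW) h4

-- The translated mollifier `ρ(x - ·)` is an admissible test function of integral one. Its support
-- lies in `K`, so truncating `u` outside `K` is not seen.
open scoped Convolution in
theorem LaplacianGE.le_laplacian_mollification {V : Set F} {m : ℝ} {u : F → ℝ}
    (hΔ : LaplacianGE V m u) {K : Set F} (hK : IsCompact K) (hKV : K ⊆ V)
    (hu : ContinuousOn u V) (ρ : ContDiffBump (0 : F)) {x : F}
    (hx : closedBall x ρ.rOut ⊆ K) :
    m ≤ Δ (ρ.normed volume ⋆[ContinuousLinearMap.lsmul ℝ ℝ] K.indicator u) x := by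
  have hloc : LocallyIntegrable (K.indicator u) :=
    ((hu.mono hKV).integrableOn_compact hK).integrable_indicator hK.measurableSet
      |>.locallyIntegrable
  have hρ : ContDiff ℝ ∞ (ρ.normed volume) := ρ.contDiff_normed
  have hρ2 : ContDiff ℝ 2 (ρ.normed volume) := contDiff_infty.1 hρ 2
  rw [laplacian_convolution_left ρ.hasCompactSupport_normed hρ hloc]
  set φ : F → ℝ := fun t => ρ.normed volume (x - t)
  have hφ : ContDiff ℝ ∞ φ := hρ.comp (contDiff_const.sub contDiff_id)
  have hsupp : tsupport φ ⊆ closedBall x ρ.rOut := by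
    refine closure_minimal (fun t ht => ?_) isClosed_closedBall
    have h1 : x - t ∈ Function.support (ρ.normed volume) := ht
    rw [ρ.support_normed_eq, mem_ball_zero_iff] at h1
    rw [mem_closedBall, dist_comm, dist_eq_norm]
    exact h1.le
  have hcs : HasCompactSupport φ :=
    (isCompact_closedBall x ρ.rOut).of_isClosed_subset (isClosed_tsupport φ) hsupp
  have h := hΔ φ hφ hcs ((hsupp.trans hx).trans hKV) fun t => ρ.nonneg_normed _
  have hint : ∫ t, φ t = 1 := by
    rw [← ρ.integral_normed (μ := volume)]
    exact integral_sub_left_eq_self (ρ.normed volume) volume x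
  rw [hint, mul_one] at h
  refine h.trans_eq (integral_congr_ae (Eventually.of_forall fun t => ?_))
  have h1 : Δ φ t = Δ (ρ.normed volume) (x - t) := laplacian_comp_const_sub hρ2 x t
  by_cases ht : t ∈ K
  · simp only [indicator_of_mem ht, ← h1, mul_comm]
  · have h2 : Δ φ t = 0 := by
      by_contra h0
      exact ht (hx (hsupp (support_laplacian_subset φ h0)))
    simp only [← h1, h2, zero_mul, mul_zero]

open scoped Convolution in
/-- A continuous function with `Δu ≥ m` in the sense of distributions has `Δu ≥ m` in the
viscosity sense. -/
theorem LaplacianGE.le_laplacian_of_isLocalMax {V : Set F} (hV : IsOpen V) {m : ℝ} {u h : F → ℝ}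
    (hΔ : LaplacianGE V m u) (hu : ContinuousOn u V) (hh : ContDiff ℝ 2 h) {y : F} (hy : y ∈ V)
    (hmax : IsLocalMax (fun x => u x - h x) y) : m ≤ Δ h y := by
  by_contra! hlt
  -- Adding `δ|x - y|²` to `h` makes the maximum strict, and for small `δ` the Laplacian stays below
  -- `m`. The strict maximum then survives mollification of `u`.
  obtain ⟨δ, hδ, hδm⟩ : ∃ δ : ℝ, 0 < δ ∧ Δ h y + δ * (2 * Module.finrank ℝ F) < m := by
    have hc : Tendsto (fun δ : ℝ => Δ h y + δ * (2 * Module.finrank ℝ F)) (𝓝[>] 0)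
        (𝓝 (Δ h y + 0 * (2 * Module.finrank ℝ F))) :=
      (Continuous.tendsto (by fun_prop) 0).mono_left nhdsWithin_le_nhds
    have := hc.eventually (gt_mem_nhds (by simpa using hlt))
    obtain ⟨δ, h1, h2⟩ := (this.and self_mem_nhdsWithin).exists
    exact ⟨δ, h2, h1⟩
  set q : F → ℝ := fun x => ‖x - y‖ ^ 2 with hq_def
  have hq : ContDiff ℝ 2 q := (contDiff_id.sub contDiff_const).norm_sq ℝ
  set k : F → ℝ := h + δ • q with hk
  have hkc : ContDiff ℝ 2 k := hh.add (contDiff_const.smul hq)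
  have hΔk : ∀ x, Δ k x = Δ h x + δ * (2 * Module.finrank ℝ F) := fun x => by
    have h1 : Δ (h + δ • q) x = Δ h x + Δ (δ • q) x :=
      hh.contDiffAt.laplacian_add (contDiff_const.smul hq).contDiffAt
    rw [hk, h1, InnerProductSpace.laplacian_smul δ hq.contDiffAt, laplacian_norm_sub_sq,
      smul_eq_mul]
  have hnear : ∀ᶠ x in 𝓝 y, x ∈ V ∧ Δ k x < m ∧ u x - h x ≤ u y - h y := by
    have h1 : ∀ᶠ x in 𝓝 y, x ∈ V := hV.mem_nhds hy
    refine h1.and (Eventually.and ?_ hmax)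
    refine (continuous_laplacian hkc).continuousAt.eventually (gt_mem_nhds ?_)
    rwa [hΔk]
  obtain ⟨R', hR', hball⟩ := Metric.eventually_nhds_iff_ball.1 hnear
  set R := R' / 3 with hR
  have hRpos : 0 < R := by positivity
  set K := closedBall y (2 * R)
  have hKball : K ⊆ ball y R' := closedBall_subset_ball (by linarith)
  have hKV : K ⊆ V := fun x hx => (hball x (hKball hx)).1
  have hK : IsCompact K := isCompact_closedBall y (2 * R)
  -- On the sphere of radius `R` the penalty costs `δR²`, whereas replacing `u` by its mollification
  -- changes the comparison by at most `2η = δR²/2`. The maximum of `w - k` is therefore interior.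
  set η := δ * R ^ 2 / 4
  have hη : 0 < η := by positivity
  obtain ⟨ε, hε, hunif⟩ := Metric.uniformContinuousOn_iff.1
    (hK.uniformContinuousOn_of_continuous (hu.mono hKV)) η hη
  set σ := min ε R
  have hσ : 0 < σ := lt_min hε hRpos
  let ρ : ContDiffBump (0 : F) := ⟨σ / 2, σ, by positivity, by linarith⟩
  set w := ρ.normed volume ⋆[ContinuousLinearMap.lsmul ℝ ℝ] K.indicator u
  have hint : Integrable (K.indicator u) :=
    ((hu.mono hKV).integrableOn_compact hK).integrable_indicator hK.measurableSet
  have hsub : ∀ x ∈ closedBall y R, closedBall x σ ⊆ K := fun x hx =>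
    closedBall_subset_closedBall' (by
      have := mem_closedBall.1 hx
      have : σ ≤ R := min_le_right _ _
      linarith)
  have hclose : ∀ x ∈ closedBall y R, |w x - u x| ≤ η := by
    intro x hx
    have hxK : x ∈ K := hsub x hx (mem_closedBall_self hσ.le)
    have := ρ.dist_normed_convolution_le (x₀ := x) (ε := η) hint.aestronglyMeasurable
      fun t ht => by
        have htK : t ∈ K := hsub x hx (ball_subset_closedBall ht)
        rw [indicator_of_mem htK, indicator_of_mem hxK]
        exact (hunif t htK x hxK ((mem_ball.1 ht).trans_le (min_le_left _ _))).le
    rwa [indicator_of_mem hxK, Real.dist_eq] at this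
  have hw : ContDiff ℝ 2 w :=
    ρ.hasCompactSupport_normed.contDiff_convolution_left (n := 2) _
      (contDiff_infty.1 (ρ.contDiff_normed (n := ⊤)) 2) hint.locallyIntegrable
  obtain ⟨x, hx, hxmax⟩ := (isCompact_closedBall y R).exists_isMaxOn
    ⟨y, mem_closedBall_self hRpos.le⟩ (hw.sub hkc).continuous.continuousOn
  have hxball : x ∈ ball y R := by
    rcases (mem_closedBall.1 hx).lt_or_eq with h | h
    · exact h
    exfalso
    have h1 := hxmax (mem_closedBall_self hRpos.le)
    have h2 := (hball x (hKball (hsub x hx (mem_closedBall_self hσ.le)))).2.2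
    have h3 := abs_le.1 (hclose x hx)
    have h4 := abs_le.1 (hclose y (mem_closedBall_self hRpos.le))
    rw [dist_eq_norm] at h
    simp only [mem_ofPred_eq, hk, hq_def, Pi.add_apply, Pi.smul_apply, smul_eq_mul, h,
      sub_self, norm_zero] at h1
    have h5 : η = δ * R ^ 2 / 4 := rfl
    nlinarith
  have hloc : IsLocalMax (w - k) x :=
    hxmax.isLocalMax (mem_of_superset (isOpen_ball.mem_nhds hxball) ball_subset_closedBall)
  have h1 := laplacian_nonpos_of_isLocalMax (hw.sub hkc) hloc
  have h1' : Δ (w - k) x = Δ w x - Δ k x := hw.contDiffAt.laplacian_sub hkc.contDiffAt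
  change Δ (w - k) x ≤ 0 at h1
  rw [h1'] at h1
  have h2 := hΔ.le_laplacian_mollification hK hKV hu ρ (hsub x hx)
  have h3 := (hball x (hKball (hsub x hx (mem_closedBall_self hσ.le)))).2.1
  linarith

end Viscosity

/-! ### Hopf's lemma and the strong maximum principle -/

section Hopf

open Filter Topology Laplacian

variable {F : Type*} [NormedAddCommGroup F] [InnerProductSpace ℝ F]

theorem contDiff_gaussian (a : ℝ) (z : F) :
    ContDiff ℝ 2 fun y : F => Real.exp (-a * ‖y - z‖ ^ 2) :=
  (contDiff_const.mul ((contDiff_id.sub contDiff_const).norm_sq ℝ)).exp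

variable [FiniteDimensional ℝ F]

theorem laplacian_gaussian (a : ℝ) (z x : F) :
    Δ (fun y : F => Real.exp (-a * ‖y - z‖ ^ 2)) x =
      (4 * a ^ 2 * ‖x - z‖ ^ 2 - 2 * a * Module.finrank ℝ F) * Real.exp (-a * ‖x - z‖ ^ 2) := by
  set b := stdOrthonormalBasis ℝ F
  rw [laplacian_eq_sum_deriv_deriv b (contDiff_gaussian a z)]
  have : ∀ i, deriv (deriv fun t : ℝ => Real.exp (-a * ‖x + t • b i - z‖ ^ 2)) 0 =
      (4 * a ^ 2 * ‖inner ℝ (b i) (x - z)‖ ^ 2 - 2 * a) * Real.exp (-a * ‖x - z‖ ^ 2) := by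
    intro i
    have he : ‖b i‖ = 1 := by simp
    set d := inner ℝ (b i) (x - z)
    have h1 : (fun t : ℝ => Real.exp (-a * ‖x + t • b i - z‖ ^ 2)) =
        fun t => Real.exp (-a * (‖x - z‖ ^ 2 + 2 * d * t + t ^ 2)) := by
      ext t
      rw [show x + t • b i - z = (x - z) + t • b i by abel, norm_add_sq_real, norm_smul, he,
        inner_smul_right, mul_one, Real.norm_eq_abs, sq_abs, real_inner_comm]
      simp only [d]
      ring_nf
    have hq : ∀ t : ℝ, HasDerivAt (fun t : ℝ => -a * (‖x - z‖ ^ 2 + 2 * d * t + t ^ 2))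
        (-a * (2 * d + 2 * t)) t := fun t => by
      have := ((((hasDerivAt_id t).const_mul (2 * d)).const_add (‖x - z‖ ^ 2)).fun_add
        (hasDerivAt_pow 2 t)).const_mul (-a)
      simpa using this
    have h2 : deriv (fun t : ℝ => Real.exp (-a * (‖x - z‖ ^ 2 + 2 * d * t + t ^ 2))) =
        fun t => Real.exp (-a * (‖x - z‖ ^ 2 + 2 * d * t + t ^ 2)) * (-a * (2 * d + 2 * t)) :=
      funext fun t => (hq t).exp.deriv
    have hl : HasDerivAt (fun t : ℝ => -a * (2 * d + 2 * t)) (-a * (2 * 1)) 0 :=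
      (((hasDerivAt_id (0 : ℝ)).const_mul 2).const_add _).const_mul _
    have h3 := ((hq 0).exp.fun_mul hl).deriv
    rw [h1, h2, h3, Real.norm_eq_abs, sq_abs]
    simp only [mul_zero, add_zero, ne_eq, OfNat.ofNat_ne_zero, not_false_eq_true, zero_pow]
    ring
  simp_rw [this]
  rw [← Finset.sum_mul, Finset.sum_sub_distrib, ← Finset.mul_sum, b.sum_sq_norm_inner_right]
  simp [mul_comm]

variable [MeasurableSpace F] [BorelSpace F]

/-- Hopf's boundary point lemma. -/
theorem LaplacianGE.normal_deriv_neg {z p : F} {u : F → ℝ} {ρ : ℝ}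
    (hΔ : LaplacianGE (ball z ρ) 0 u) (hρ : 0 < ρ)
    (hu : ContinuousOn u (closedBall z ρ)) (hneg : ∀ x ∈ ball z ρ, u x < 0)
    (hp : dist p z = ρ) (hup : u p = 0) {c : ℝ}
    (hc : HasDerivWithinAt (fun t : ℝ => u (p + t • (z - p))) c (Ici 0) 0) : c < 0 := by
  have hle : ∀ x ∈ closedBall z ρ, u x ≤ 0 := by
    rw [← closure_ball z hρ.ne'] at hu ⊢
    intro x hx
    exact le_on_closure (f := u) (g := fun _ => 0) (fun y hy => (hneg y hy).le) hu
      continuousOn_const hx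
  set N : ℝ := (Module.finrank ℝ F : ℝ)
  -- For `|y - z| ≥ ρ/2` this gives `4a²|y - z|² ≥ 4a(N + 1) > 2aN`, so the Gaussian is strictly
  -- subharmonic on the annulus `A`.
  set a : ℝ := 4 * (N + 1) / ρ ^ 2
  have hN : 0 ≤ N := Nat.cast_nonneg _
  have ha : 0 < a := by positivity
  have haρ : a * ρ ^ 2 = 4 * (N + 1) := by simp only [a]; field_simp
  set g : F → ℝ := fun y => Real.exp (-a * ‖y - z‖ ^ 2)
  have hg : ContDiff ℝ 2 g := contDiff_gaussian a z
  obtain ⟨ε, hε, hεle⟩ : ∃ ε : ℝ, 0 < ε ∧ ∀ x ∈ closedBall z (ρ / 2), u x ≤ -ε := by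
    obtain ⟨x, hx, hxm⟩ := (isCompact_closedBall z (ρ / 2)).exists_isMaxOn
      ⟨z, mem_closedBall_self (by positivity)⟩
      (hu.mono (closedBall_subset_closedBall (by linarith)))
    refine ⟨-u x, neg_pos.2 (hneg x (closedBall_subset_ball (by linarith) hx)), fun y hy => ?_⟩
    rw [neg_neg]
    exact hxm hy
  set h : F → ℝ := (-ε) • g
  have hh : ContDiff ℝ 2 h := contDiff_const.smul hg
  set G := Real.exp (-a * ρ ^ 2)
  set A := closedBall z ρ \ ball z (ρ / 2)
  have hpA : p ∈ A := ⟨mem_closedBall.2 hp.le, fun hb => by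
    have := mem_ball.1 hb
    linarith⟩
  have hAc : IsCompact A := (isCompact_closedBall z ρ).diff isOpen_ball
  -- Since `Δh < 0`, an interior maximum contradicts the viscosity inequality. On the inner sphere
  -- `u ≤ -ε` and `-h ≤ ε`; on the outer one `u ≤ 0` and `-h = εG`.
  have hbar : ∀ x ∈ A, u x - h x ≤ ε * G := by
    obtain ⟨y, hy, hym⟩ := hAc.exists_isMaxOn ⟨p, hpA⟩
      ((hu.mono sdiff_subset).sub hh.continuous.continuousOn)
    intro x hx
    refine (hym hx).trans ?_
    change u y - -ε * Real.exp (-a * ‖y - z‖ ^ 2) ≤ ε * G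
    have hy1 : ‖y - z‖ ≤ ρ := by simpa [dist_eq_norm] using hy.1
    have hy2 : ρ / 2 ≤ ‖y - z‖ := by simpa [dist_eq_norm] using hy.2
    rcases hy1.lt_or_eq with h1 | h1
    · rcases hy2.lt_or_eq with h2 | h2
      · exfalso
        have hynhds : A ∈ 𝓝 y := by
          have : ball z ρ \ closedBall z (ρ / 2) ∈ 𝓝 y :=
            (isOpen_ball.sdiff isClosed_closedBall).mem_nhds
              ⟨by simpa [dist_eq_norm] using h1, by simpa [dist_eq_norm] using h2⟩
          exact mem_of_superset this (sdiff_subset_sdiff ball_subset_closedBall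
            ball_subset_closedBall)
        have h3 := hΔ.le_laplacian_of_isLocalMax isOpen_ball (hu.mono ball_subset_closedBall) hh
          (by simpa [dist_eq_norm] using h1) (hym.isLocalMax hynhds)
        rw [InnerProductSpace.laplacian_smul (-ε) hg.contDiffAt, laplacian_gaussian,
          smul_eq_mul] at h3
        have h4 : 0 < 4 * a ^ 2 * ‖y - z‖ ^ 2 - 2 * a * N := by
          have h5 : (ρ / 2) ^ 2 ≤ ‖y - z‖ ^ 2 := by gcongr
          have h6 : 4 * a ^ 2 * (ρ / 2) ^ 2 ≤ 4 * a ^ 2 * ‖y - z‖ ^ 2 := by gcongr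
          have h7 : 4 * a ^ 2 * (ρ / 2) ^ 2 = a * (4 * (N + 1)) := by rw [← haρ]; ring
          nlinarith
        have := mul_pos hε (mul_pos h4 (Real.exp_pos (-a * ‖y - z‖ ^ 2)))
        linarith
      · have h3 := hεle y (by simp [dist_eq_norm, ← h2])
        have h4 : Real.exp (-a * ‖y - z‖ ^ 2) ≤ 1 :=
          Real.exp_le_one_iff.2 (by nlinarith [sq_nonneg ‖y - z‖])
        have h5 : 0 < G := Real.exp_pos _
        nlinarith [mul_pos hε h5]
    · have := hle y hy.1
      rw [h1]
      change u y - -ε * G ≤ ε * G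
      linarith
  have hzp : ‖z - p‖ = ρ := by rw [← hp, dist_comm, dist_eq_norm]
  -- The barrier along the inward radius from `p`. It dominates `u`, agrees with it at `t = 0`, and
  -- has negative slope there.
  set ψ : ℝ → ℝ := fun t => ε * G - ε * Real.exp (-a * (ρ ^ 2 * (1 - t) ^ 2))
  have hψ : HasDerivAt ψ (-(ε * (G * (2 * a * ρ ^ 2)))) 0 := by
    have h1 : HasDerivAt (fun t : ℝ => -a * (ρ ^ 2 * (1 - t) ^ 2)) (2 * a * ρ ^ 2) 0 := by
      have := ((((hasDerivAt_id (0 : ℝ)).const_sub 1).fun_pow 2).const_mul (ρ ^ 2)).const_mul (-a)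
      exact this.congr_deriv (by simp; ring)
    have := (h1.exp.const_mul ε).const_sub (ε * G)
    exact this.congr_deriv (by simp [G])
  have hcmp : ∀ t ∈ Icc (0 : ℝ) (1 / 2), u (p + t • (z - p)) ≤ ψ t := by
    intro t ht
    have hn : ‖p + t • (z - p) - z‖ = (1 - t) * ρ := by
      rw [show p + t • (z - p) - z = (t - 1) • (z - p) by rw [sub_smul, one_smul]; abel,
        norm_smul, hzp, Real.norm_eq_abs, abs_sub_comm, abs_of_nonneg (by linarith [ht.2])]
    have hA : p + t • (z - p) ∈ A := by
      constructor
      · rw [mem_closedBall, dist_eq_norm, hn]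
        nlinarith [ht.1]
      · rw [mem_ball, dist_eq_norm, hn]
        nlinarith [ht.2]
    have h1 := hbar _ hA
    change _ - -ε * Real.exp (-a * ‖p + t • (z - p) - z‖ ^ 2) ≤ _ at h1
    rw [hn] at h1
    have : ((1 - t) * ρ) ^ 2 = ρ ^ 2 * (1 - t) ^ 2 := by ring
    rw [this] at h1
    simp only [ψ]
    linarith
  have hlt : -(ε * (G * (2 * a * ρ ^ 2))) < 0 := by
    have : 0 < G := Real.exp_pos _
    exact neg_neg_of_pos (by positivity)
  refine lt_of_le_of_lt ?_ hlt
  have hs1 := hasDerivWithinAt_iff_tendsto_slope.1 hc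
  have hs2 := hasDerivWithinAt_iff_tendsto_slope.1 (hψ.hasDerivWithinAt (s := Ici 0))
  have hset : Ici (0 : ℝ) \ {0} = Ioi 0 := Ici_sdiff_left
  rw [hset] at hs1 hs2
  refine le_of_tendsto_of_tendsto hs1 hs2 ?_
  filter_upwards [Ioo_mem_nhdsGT (show (0 : ℝ) < 1 / 2 by norm_num)] with t ht
  rw [slope_def_field, slope_def_field]
  have h0 : ψ 0 = 0 := by simp [ψ, G]
  have h1 := hcmp t ⟨ht.1.le, ht.2.le⟩
  have : 0 < t := ht.1
  simp only [zero_smul, add_zero, hup, h0, sub_zero]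
  gcongr

/-- The strong maximum principle. -/
theorem LaplacianGE.neg_of_nonpos {D : Set F} {u : F → ℝ} (hΔ : LaplacianGE D 0 u)
    (hD : IsOpen D) (hDc : IsPreconnected D) (hu : DifferentiableOn ℝ u D)
    (hle : ∀ x ∈ D, u x ≤ 0) {x₁ : F} (hx₁ : x₁ ∈ D) (hlt : u x₁ < 0) :
    ∀ x ∈ D, u x < 0 := by
  have hcont : ContinuousOn u D := hu.continuousOn
  set Z := {x ∈ D | u x = 0}
  -- If `u(z) < 0` for some `z` near a zero, the largest ball about `z` without zeros touches a zero
  -- `p`. There `u` has an interior maximum, so its gradient vanishes, against Hopf's lemma.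
  have hZo : IsOpen Z := by
    refine isOpen_iff_mem_nhds.2 fun y hy => ?_
    obtain ⟨R', hR', hsub⟩ := Metric.isOpen_iff.1 hD y hy.1
    set R := R' / 3 with hR
    have hRpos : 0 < R := by positivity
    refine mem_of_superset (ball_mem_nhds y hRpos) fun z hz => ?_
    have hzD : z ∈ D := hsub (ball_subset_ball (by linarith) hz)
    refine ⟨hzD, ?_⟩
    by_contra hne
    have hBD : closedBall y (2 * R) ⊆ D := (closedBall_subset_ball (by linarith)).trans hsub
    set S := closedBall y (2 * R) ∩ u ⁻¹' {0}
    have hS : IsCompact S := by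
      refine (isCompact_closedBall y (2 * R)).of_isClosed_subset ?_ inter_subset_left
      exact (hcont.mono hBD).preimage_isClosed_of_isClosed isClosed_closedBall isClosed_singleton
    have hyS : y ∈ S := ⟨mem_closedBall_self (by positivity), hy.2⟩
    obtain ⟨p, hpS, hpd⟩ := hS.exists_infDist_eq_dist ⟨y, hyS⟩ z
    set ρ := dist p z with hρ
    have hpz : p ≠ z := fun h => hne (h ▸ hpS.2)
    have hρpos : 0 < ρ := dist_pos.2 hpz
    have hρR : ρ < R := by
      have h1 := infDist_le_dist_of_mem (x := z) hyS
      rw [hpd, dist_comm z p] at h1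
      exact h1.trans_lt (mem_ball.1 hz)
    have hcl : closedBall z ρ ⊆ closedBall y (2 * R) :=
      closedBall_subset_closedBall' (by linarith [mem_ball.1 hz])
    have hnegball : ∀ x ∈ ball z ρ, u x < 0 := by
      intro x hx
      have hxB := hcl (ball_subset_closedBall hx)
      refine (hle x (hBD hxB)).lt_of_ne fun h0 => ?_
      have h1 := infDist_le_dist_of_mem (x := z) (show x ∈ S from ⟨hxB, h0⟩)
      rw [hpd, dist_comm z p, dist_comm z x] at h1
      exact absurd (mem_ball.1 hx) (not_lt.2 h1)
    have hpD : p ∈ D := hBD hpS.1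
    have hmax : IsLocalMax u p := by
      filter_upwards [hD.mem_nhds hpD] with x hx
      rw [show u p = 0 from hpS.2]
      exact hle x hx
    have hfd : HasFDerivAt u (0 : F →L[ℝ] ℝ) p := by
      have := (hu.differentiableAt (hD.mem_nhds hpD)).hasFDerivAt
      rwa [hmax.fderiv_eq_zero] at this
    have hl : HasDerivAt (fun t : ℝ => p + t • (z - p)) (z - p) 0 := by
      simpa using ((hasDerivAt_id (0 : ℝ)).smul_const (z - p)).const_add p
    have hcomp : HasDerivAt (fun t : ℝ => u (p + t • (z - p))) 0 0 := by
      have hfd' : HasFDerivAt u (0 : F →L[ℝ] ℝ) (p + (0 : ℝ) • (z - p)) := by simpa using hfd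
      exact hfd'.comp_hasDerivAt (0 : ℝ) hl
    exact lt_irrefl _ ((hΔ.mono ((ball_subset_closedBall.trans hcl).trans hBD)).normal_deriv_neg
      hρpos (hcont.mono (hcl.trans hBD)) hnegball rfl hpS.2 hcomp.hasDerivWithinAt)
  have hNo : IsOpen {x ∈ D | u x < 0} := hcont.isOpen_inter_preimage hD isOpen_Iio
  intro x hx
  by_contra hx0
  obtain ⟨w, -, hw1, hw2⟩ := hDc _ _ hZo hNo
    (fun y hy => (hle y hy).eq_or_lt.imp (fun h => ⟨hy, h⟩) fun h => ⟨hy, h⟩)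
    ⟨x, hx, hx, le_antisymm (hle x hx) (not_lt.1 hx0)⟩ ⟨x₁, hx₁, hx₁, hlt⟩
  exact hw2.2.ne hw1.2

end Hopf

/-! ### Growth of local solutions and the choice of centres in `Ω` -/

namespace HalfBallObstacle

open Filter Topology Laplacian

variable {n : ℕ} {u : E n → ℝ}

theorem LaplacianEqIndicator.integral_mul_laplacian {U D : Set (E n)}
    (h : LaplacianEqIndicator U D u) {φ : E n → ℝ} (hφ : ContDiff ℝ ∞ φ)
    (hc : HasCompactSupport φ) (hs : tsupport φ ⊆ U) :
    ∫ x, u x * Δ φ x = ∫ x, D.indicator 1 x * φ x := by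
  have h0 : ∀ x, x ∉ U → φ x = 0 := fun x hx => image_eq_zero_of_notMem_tsupport fun h => hx (hs h)
  have h1 : ∀ x, x ∉ U → Δ φ x = 0 := fun x hx => by
    by_contra hne
    exact hx (hs (support_laplacian_subset φ hne))
  have := h φ hφ hc hs
  rwa [setIntegral_eq_integral_of_forall_compl_eq_zero fun x hx => by rw [h1 x hx, mul_zero],
    setIntegral_eq_integral_of_forall_compl_eq_zero fun x hx => by rw [h0 x hx, mul_zero]] at this

theorem LaplacianEqIndicator.laplacianGE_zero {U D : Set (E n)}
    (h : LaplacianEqIndicator U D u) : LaplacianGE U 0 u := by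
  intro φ hφ hc hs hpos
  rw [h.integral_mul_laplacian hφ hc hs, zero_mul]
  exact integral_nonneg fun x => mul_nonneg (indicator_nonneg (fun _ _ => zero_le_one) x) (hpos x)

/-- A test function supported in `D` sees the indicator as the constant one. -/
theorem LaplacianEqIndicator.laplacianGE_one {U D : Set (E n)}
    (h : LaplacianEqIndicator U D u) (hD : D ⊆ U) : LaplacianGE D 1 u := by
  intro φ hφ hc hs _
  rw [h.integral_mul_laplacian hφ hc (hs.trans hD), one_mul]
  refine (integral_congr_ae (Eventually.of_forall fun x => ?_)).le
  by_cases hx : x ∈ D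
  · simp [hx]
  · simp [hx, image_eq_zero_of_notMem_tsupport fun h => hx (hs h)]

variable [NeZero n] {M : ℝ}

theorem continuous_coord : Continuous fun x : E n => x 0 := by fun_prop

theorem isOpen_halfBall (z : E n) (r : ℝ) : IsOpen (halfBall z r) :=
  (isOpen_lt continuous_const continuous_coord).inter isOpen_ball

theorem mem_Omega_iff {r : ℝ} {x : E n} :
    x ∈ Omega r u ↔ x ∈ halfBall 0 r ∧ fderiv ℝ u x ≠ 0 := by
  simp [Omega, gradient]

theorem Omega_subset (r : ℝ) (u : E n → ℝ) : Omega r u ⊆ halfBall 0 r := fun _ h => h.1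

theorem isOpen_Omega {r : ℝ} (hu : ContDiffOn ℝ 1 u (halfBall 0 r)) : IsOpen (Omega r u) := by
  have h : Omega r u = halfBall 0 r ∩ fderiv ℝ u ⁻¹' {0}ᶜ := by
    ext x
    simp [mem_Omega_iff]
  rw [h]
  exact (hu.continuousOn_fderiv_of_isOpen (isOpen_halfBall 0 r)
    le_rfl).isOpen_inter_preimage (isOpen_halfBall 0 r) isOpen_compl_singleton

/-- Growth of a local solution away from a point `x₁` of `Ω(u)`. -/
theorem LocalSolution.exists_growth (hu : LocalSolution 1 M u) {x₁ : E n} (hx₁ : x₁ ∈ Omega 1 u)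
    {s c : ℝ} (hs : 0 ≤ s) (hc : 0 < c) (hcn : c * (2 * n) < 1)
    (hball : closedBall x₁ s ⊆ ball 0 1)
    (hflat : ∀ x ∈ closedBall x₁ s, x 0 = 0 → -(c * dist x x₁ ^ 2) < u x₁) :
    ∃ y, dist y x₁ = s ∧ 0 < y 0 ∧ u x₁ + c * s ^ 2 ≤ u y := by
  set q : E n → ℝ := fun y => ‖y - x₁‖ ^ 2
  have hq : ContDiff ℝ 2 q := (contDiff_id.sub contDiff_const).norm_sq ℝ
  set h : E n → ℝ := c • q
  have hh : ContDiff ℝ 2 h := contDiff_const.smul hq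
  set K := closedBall x₁ s ∩ {x | 0 ≤ x 0}
  have hK : IsCompact K :=
    (isCompact_closedBall x₁ s).inter_right (isClosed_le continuous_const continuous_coord)
  have hKsub : K ⊆ halfBall 0 1 ∪ flatBall n 1 := by
    rintro x ⟨hx1, hx2⟩
    rcases (show 0 ≤ x 0 from hx2).lt_or_eq with h | h
    · exact Or.inl ⟨h, hball hx1⟩
    · exact Or.inr ⟨h.symm, hball hx1⟩
  have hx₁K : x₁ ∈ K := ⟨mem_closedBall_self hs, (show 0 < x₁ 0 from hx₁.1.1).le⟩
  obtain ⟨y, hy, hmax⟩ := hK.exists_isMaxOn ⟨x₁, hx₁K⟩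
    ((hu.continuousOn.mono hKsub).sub hh.continuous.continuousOn)
  have hle : u x₁ - c * ‖x₁ - x₁‖ ^ 2 ≤ u y - c * ‖y - x₁‖ ^ 2 := hmax hx₁K
  simp only [sub_self, norm_zero, ne_eq, OfNat.ofNat_ne_zero, not_false_eq_true, zero_pow,
    mul_zero, sub_zero] at hle
  have hy0 : 0 < y 0 := by
    rcases (show 0 ≤ y 0 from hy.2).lt_or_eq with h | h
    · exact h
    exfalso
    have h1 := hflat y hy.1 h.symm
    rw [hu.eq_zero y ⟨h.symm, hball hy.1⟩] at hle
    rw [dist_eq_norm] at h1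
    linarith
  rcases (mem_closedBall.1 hy.1).lt_or_eq with hlt | heq
  · exfalso
    have hyH : y ∈ halfBall 0 1 := ⟨hy0, hball hy.1⟩
    have hnhds : K ∈ 𝓝 y := by
      filter_upwards [isOpen_ball.mem_nhds (mem_ball.2 hlt),
        (isOpen_lt continuous_const continuous_coord).mem_nhds hy0] with x h1 h2
      exact ⟨ball_subset_closedBall h1, (show 0 < x 0 from h2).le⟩
    have hloc := hmax.isLocalMax hnhds
    -- If `∇u(y) = 0`, differentiating `u - h` at its maximum along `y - x₁` gives `2c|y - x₁|² =
    -- 0`, hence `y = x₁ ∈ Ω`.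
    have hyΩ : y ∈ Omega 1 u := by
      by_cases hyx : y = x₁
      · exact hyx ▸ hx₁
      refine mem_Omega_iff.2 ⟨hyH, fun h0 => hyx ?_⟩
      have hud : DifferentiableAt ℝ u y :=
        (hu.contDiffOn.differentiableOn one_ne_zero).differentiableAt
          ((isOpen_halfBall 0 1).mem_nhds hyH)
      have hfd : HasFDerivAt u (0 : E n →L[ℝ] ℝ) y := by rw [← h0]; exact hud.hasFDerivAt
      have hl : HasDerivAt (fun t : ℝ => y + t • (y - x₁)) (y - x₁) 0 := by
        simpa using ((hasDerivAt_id (0 : ℝ)).smul_const (y - x₁)).const_add y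
      have hfd' : HasFDerivAt u (0 : E n →L[ℝ] ℝ) (y + (0 : ℝ) • (y - x₁)) := by simpa using hfd
      have h1 : HasDerivAt (fun t : ℝ => u (y + t • (y - x₁))) 0 0 :=
        (hfd'.comp_hasDerivAt (0 : ℝ) hl).congr_deriv rfl
      have h2 : (fun t : ℝ => h (y + t • (y - x₁))) =
          fun t => c * ((1 + t) ^ 2 * ‖y - x₁‖ ^ 2) := by
        ext t
        change c * ‖y + t • (y - x₁) - x₁‖ ^ 2 = _
        rw [show y + t • (y - x₁) - x₁ = (1 + t) • (y - x₁) by rw [add_smul, one_smul]; abel,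
          norm_smul, mul_pow, Real.norm_eq_abs, sq_abs]
      have h3 : HasDerivAt (fun t : ℝ => h (y + t • (y - x₁))) (c * (2 * ‖y - x₁‖ ^ 2)) 0 := by
        rw [h2]
        have := ((((hasDerivAt_id (0 : ℝ)).const_add 1).fun_pow 2).mul_const
          (‖y - x₁‖ ^ 2)).const_mul c
        simpa using this
      have h4 : IsLocalMax (fun t : ℝ => u (y + t • (y - x₁)) - h (y + t • (y - x₁))) 0 := by
        have ht : Tendsto (fun t : ℝ => y + t • (y - x₁)) (𝓝 0) (𝓝 y) := by
          simpa using hl.continuousAt.tendsto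
        have := ht.eventually hloc
        simpa [IsLocalMax, IsMaxFilter] using this
      have h5 := h4.hasDerivAt_eq_zero (h1.fun_sub h3)
      have h6 : ‖y - x₁‖ ^ 2 = 0 := by
        have : c * (2 * ‖y - x₁‖ ^ 2) = 0 := by linarith
        simpa [hc.ne'] using this
      exact sub_eq_zero.1 (norm_eq_zero.1 (pow_eq_zero_iff two_ne_zero |>.1 h6))
    have h1 := (hu.laplacian_eq.laplacianGE_one (Omega_subset 1 u)).le_laplacian_of_isLocalMax
      (isOpen_Omega hu.contDiffOn) (hu.contDiffOn.continuousOn.mono (Omega_subset 1 u)) hh hyΩ hloc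
    rw [InnerProductSpace.laplacian_smul c hq.contDiffAt, laplacian_norm_sub_sq, smul_eq_mul,
      finrank_euclideanSpace_fin] at h1
    linarith
  · refine ⟨y, heq, hy0, ?_⟩
    rw [← dist_eq_norm, heq] at hle
    linarith

/-- Quadratic growth at a limit of points of `Ω(u)`. -/
theorem LocalSolution.le_sSup_image (hu : LocalSolution 1 M u) {x₀ : E n} {r c : ℝ} (hr : 0 < r)
    (hc : 0 < c) (hcn : c * (2 * n) < 1) (hball : ball x₀ r ⊆ ball 0 1)
    (happ : ∀ η > 0, ∃ x₁ ∈ Omega 1 u, dist x₁ x₀ < η ∧ u x₀ - η < u x₁ ∧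
      ∀ x ∈ ball x₀ r, x 0 = 0 → -(c * dist x x₁ ^ 2) < u x₁) :
    u x₀ + c * r ^ 2 ≤ sSup (u '' halfBall x₀ r) := by
  have hbdd : BddAbove (u '' halfBall x₀ r) := by
    refine ⟨M, ?_⟩
    rintro _ ⟨x, hx, rfl⟩
    exact (abs_le.1 (hu.bound x ⟨hx.1, hball hx.2⟩)).2
  have key : ∀ η ∈ Ioo (0 : ℝ) (r / 2),
      u x₀ - η + c * (r - 2 * η) ^ 2 ≤ sSup (u '' halfBall x₀ r) := by
    rintro η ⟨hη, hηr⟩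
    obtain ⟨x₁, hx₁, hd, hux, hflat⟩ := happ η hη
    -- The centre moved by less than `η`, so radius `r - 2η` leaves room inside the open ball; the
    -- loss disappears as `η → 0`.
    have hsub : closedBall x₁ (r - 2 * η) ⊆ ball x₀ r := fun x hx => by
      have h1 := mem_closedBall.1 hx
      have h2 := dist_triangle x x₁ x₀
      rw [mem_ball]
      linarith
    obtain ⟨y, hy, hy0, hle⟩ := hu.exists_growth hx₁ (by linarith) hc hcn (hsub.trans hball)
      fun x hx => hflat x (hsub hx)
    have := le_csSup hbdd ⟨y, ⟨hy0, hsub (mem_closedBall.2 hy.le)⟩, rfl⟩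
    linarith
  have hlim : Tendsto (fun η : ℝ => u x₀ - η + c * (r - 2 * η) ^ 2) (𝓝[>] 0)
      (𝓝 (u x₀ - 0 + c * (r - 2 * 0) ^ 2)) :=
    (Continuous.tendsto (by fun_prop) 0).mono_left nhdsWithin_le_nhds
  simp only [sub_zero, mul_zero] at hlim
  refine le_of_tendsto hlim ?_
  filter_upwards [Ioo_mem_nhdsGT (half_pos hr)] with η hη using key η hη

theorem inner_single_right_one (x : E n) :
    inner ℝ x (EuclideanSpace.single (0 : Fin n) (1 : ℝ)) = x 0 := by
  simp [EuclideanSpace.inner_single_right]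

theorem abs_coord_sub_le_dist (x y : E n) : |x 0 - y 0| ≤ dist x y := by
  rw [dist_eq_norm]
  exact PiLp.norm_apply_le (x - y) 0

theorem convex_halfBall (z : E n) (r : ℝ) : Convex ℝ (halfBall z r) := by
  refine Convex.inter ?_ (convex_ball z r)
  exact convex_halfSpace_gt (f := fun x : E n => x 0) ⟨fun _ _ => rfl, fun _ _ => rfl⟩ 0

/-- Below a point of positivity of `u` there is a point of `Ω(u)` where `u` is positive. -/
theorem LocalSolution.exists_mem_Omega_pos (hu : LocalSolution 1 M u) {x₀ : E n} {δ : ℝ}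
    (h0 : x₀ 0 = 0) (hball : ball x₀ δ ⊆ ball 0 1) {x : E n} (hx : x ∈ halfBall x₀ δ)
    (hux : 0 < u x) : ∃ y ∈ Omega 1 u, y ∈ ball x₀ δ ∧ 0 < u y := by
  set e : E n := EuclideanSpace.single (0 : Fin n) (1 : ℝ) with he
  set a := x 0 with ha
  have ha0 : 0 < a := hx.1
  -- The vertical segment from `Π` up to `x`, parametrised by height. As `x₀ ∈ Π`, descending does
  -- not increase the distance to `x₀`.
  set γ : ℝ → E n := fun t => x + (t - a) • e
  have hγ0 : ∀ t, γ t 0 = t := fun t => by simp [γ, e, ← ha]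
  have hγball : ∀ t ∈ Icc 0 a, γ t ∈ ball x₀ δ := by
    intro t ht
    refine lt_of_le_of_lt ?_ (mem_ball.1 hx.2)
    rw [dist_eq_norm, dist_eq_norm]
    refine le_of_sq_le_sq ?_ (norm_nonneg _)
    have h1 : inner ℝ (x - x₀) e = a := by
      rw [he, inner_single_right_one]
      simp [h0, ← ha]
    have h2 : ‖e‖ = 1 := by simp [e]
    rw [show γ t - x₀ = (x - x₀) + (t - a) • e by simp only [γ]; abel, norm_add_sq_real,
      inner_smul_right, h1, norm_smul, h2, mul_one, Real.norm_eq_abs, sq_abs]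
    nlinarith [ht.1, ht.2]
  have hγc : Continuous γ := by fun_prop
  have hγd : ∀ t, HasDerivAt γ e t := fun t => by
    have := (((hasDerivAt_id t).sub_const a).smul_const e).const_add x
    rwa [one_smul] at this
  have hc : ContinuousOn (fun t => u (γ t)) (Icc 0 a) := by
    refine hu.continuousOn.comp hγc.continuousOn fun t ht => ?_
    rcases ht.1.eq_or_lt with h | h
    · exact Or.inr ⟨by rw [mem_ofPred_eq, hγ0, h], hball (hγball t ht)⟩
    · exact Or.inl ⟨by rw [mem_ofPred_eq, hγ0]; exact h, hball (hγball t ht)⟩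
  have hxa : γ a = x := by simp [γ]
  set S := Icc 0 a ∩ (fun t => u (γ t)) ⁻¹' Iic 0
  have hS : IsCompact S :=
    isCompact_Icc.of_isClosed_subset (hc.preimage_isClosed_of_isClosed isClosed_Icc isClosed_Iic)
      inter_subset_left
  have h0S : (0 : ℝ) ∈ S := by
    refine ⟨left_mem_Icc.2 ha0.le, ?_⟩
    have : u (γ 0) = 0 :=
      hu.eq_zero _ ⟨hγ0 0, hball (hγball 0 (left_mem_Icc.2 ha0.le))⟩
    exact this.le
  -- Above the last height `s` with `u ≤ 0` the function is positive, and the mean value theorem on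
  -- `[s, a]` yields a point of nonzero gradient.
  obtain ⟨s, hsS, hs⟩ := hS.exists_isGreatest ⟨0, h0S⟩
  have hsa : s < a := by
    refine hsS.1.2.lt_of_ne fun h => ?_
    have h1 : u (γ s) ≤ 0 := hsS.2
    rw [h, hxa] at h1
    exact h1.not_gt hux
  have hH : ∀ t ∈ Ioo s a, γ t ∈ halfBall 0 1 := fun t ht =>
    ⟨by rw [mem_ofPred_eq, hγ0]; exact hsS.1.1.trans_lt ht.1,
      hball (hγball t ⟨hsS.1.1.trans ht.1.le, ht.2.le⟩)⟩
  obtain ⟨t, ht, hslope⟩ := exists_hasDerivAt_eq_slope (fun t => u (γ t))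
    (fun t => fderiv ℝ u (γ t) e) hsa (hc.mono (Icc_subset_Icc_left hsS.1.1)) fun t ht =>
      (((hu.contDiffOn.differentiableOn one_ne_zero).differentiableAt
        ((isOpen_halfBall 0 1).mem_nhds (hH t ht))).hasFDerivAt.comp_hasDerivAt t (hγd t))
  refine ⟨γ t, mem_Omega_iff.2 ⟨hH t ht, fun hz => ?_⟩,
    hγball t ⟨hsS.1.1.trans ht.1.le, ht.2.le⟩, ?_⟩
  · rw [hz] at hslope
    have h1 : u (γ s) ≤ 0 := hsS.2
    have h2 : 0 < (u (γ a) - u (γ s)) / (a - s) :=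
      div_pos (by rw [hxa]; linarith) (by linarith)
    simp only [zero_apply] at hslope
    linarith
  · by_contra! hle
    exact (hs ⟨⟨hsS.1.1.trans ht.1.le, ht.2.le⟩, hle⟩).not_gt ht.1

/-- Near a point of the flat boundary where the normal derivative is nonnegative, the solution is
nonnegative somewhere in `Ω(u)`. -/
theorem LocalSolution.exists_mem_Omega_nonneg (hu : LocalSolution 1 M u) {x₀ : E n}
    (hx₀ : x₀ ∈ flatBall n 1) (hcl : x₀ ∈ closure (Omega 1 u)) {c : ℝ} (hc : 0 ≤ c)
    (hd : HasNormalDeriv u c x₀) {η : ℝ} (hη : 0 < η) :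
    ∃ x₁ ∈ Omega 1 u, dist x₁ x₀ < η ∧ 0 ≤ u x₁ := by
  by_contra! hno
  have h0 : x₀ 0 = 0 := hx₀.1
  obtain ⟨δ', hδ', hsub'⟩ := Metric.isOpen_iff.1 isOpen_ball x₀ hx₀.2
  set δ := min δ' η
  have hδ : 0 < δ := lt_min hδ' hη
  have hball : ball x₀ δ ⊆ ball 0 1 := (ball_subset_ball (min_le_left _ _)).trans hsub'
  have hDH : halfBall x₀ δ ⊆ halfBall 0 1 := fun x hx => ⟨hx.1, hball hx.2⟩
  have hle : ∀ x ∈ halfBall x₀ δ, u x ≤ 0 := by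
    intro x hx
    by_contra! hpos
    obtain ⟨y, hy, hyb, hyp⟩ := hu.exists_mem_Omega_pos h0 hball hx hpos
    exact (hno y hy ((mem_ball.1 hyb).trans_le (min_le_right _ _))).not_gt hyp
  obtain ⟨x₁, hx₁, hdist⟩ := Metric.mem_closure_iff.1 hcl δ hδ
  rw [dist_comm] at hdist
  have hΔ : LaplacianGE (halfBall 0 1) 0 u := hu.laplacian_eq.laplacianGE_zero
  have hneg : ∀ x ∈ halfBall x₀ δ, u x < 0 :=
    (hΔ.mono hDH).neg_of_nonpos (isOpen_halfBall x₀ δ) (convex_halfBall x₀ δ).isPreconnected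
      ((hu.contDiffOn.differentiableOn one_ne_zero).mono hDH) hle ⟨hx₁.1.1, hdist⟩
      (hno x₁ hx₁ (hdist.trans_le (min_le_right _ _)))
  set e : E n := EuclideanSpace.single (0 : Fin n) (1 : ℝ) with he
  -- The ball of radius `ρ` about `x₀ + ρe` touches `Π` at `x₀`, and its closure stays within `2ρ <
  -- δ` of `x₀`.
  set ρ := δ / 3 with hρ
  have hρpos : 0 < ρ := by positivity
  set z := x₀ + ρ • e
  have hz0 : z 0 = ρ := by simp [z, e, h0]
  have hzd : dist x₀ z = ρ := by
    rw [dist_comm, dist_eq_norm]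
    simp [z, e, norm_smul, abs_of_pos hρpos]
  have hin : closedBall z ρ ⊆ ball x₀ δ := fun x hx => by
    have h1 := dist_triangle x z x₀
    rw [dist_comm z x₀, hzd] at h1
    have h2 := mem_closedBall.1 hx
    rw [mem_ball]
    linarith
  have hcoord : ∀ x, ρ - dist x z ≤ x 0 := fun x => by
    have := (abs_le.1 (abs_coord_sub_le_dist x z)).1
    linarith
  have hbD : ball z ρ ⊆ halfBall x₀ δ := fun x hx =>
    ⟨by have := hcoord x; have := mem_ball.1 hx; change 0 < x 0; linarith,
      hin (ball_subset_closedBall hx)⟩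
  have hcont : ContinuousOn u (closedBall z ρ) := by
    refine hu.continuousOn.mono fun x hx => ?_
    have h1 : 0 ≤ x 0 := by
      have := hcoord x
      have := mem_closedBall.1 hx
      linarith
    rcases h1.lt_or_eq with h | h
    · exact Or.inl ⟨h, hball (hin hx)⟩
    · exact Or.inr ⟨h.symm, hball (hin hx)⟩
  have hderiv : HasDerivWithinAt (fun t : ℝ => u (x₀ + t • (z - x₀))) (c * ρ) (Ici 0) 0 := by
    have h1 : HasDerivWithinAt (fun t : ℝ => t * ρ) (1 * ρ) (Ici 0) 0 :=
      ((hasDerivAt_id (0 : ℝ)).mul_const ρ).hasDerivWithinAt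
    have h2 : HasDerivWithinAt (fun t : ℝ => u (x₀ + t • e)) c (Ici 0) ((0 : ℝ) * ρ) := by
      rw [zero_mul]
      exact hd
    have h3 := h2.comp (0 : ℝ) h1 fun t ht => mul_nonneg ht hρpos.le
    rw [one_mul] at h3
    refine h3.congr_of_mem (fun t _ => ?_) (mem_Ici.2 le_rfl)
    simp only [Function.comp_apply, z, add_sub_cancel_left, smul_smul]
  have := (hΔ.mono (hbD.trans hDH)).normal_deriv_neg hρpos hcont (fun x hx => hneg x (hbD hx))
    hzd (hu.eq_zero x₀ hx₀) hderiv
  exact (mul_nonneg hc hρpos.le).not_gt this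

theorem exists_mem_Omega_of_eventually {x₀ : E n} (hcl : x₀ ∈ closure (Omega 1 u)) {P : E n → Prop}
    (hP : ∀ᶠ x in 𝓝[halfBall 0 1 ∪ flatBall n 1] x₀, P x) {η : ℝ} (hη : 0 < η) :
    ∃ x₁ ∈ Omega 1 u, dist x₁ x₀ < η ∧ P x₁ := by
  have : (𝓝[Omega 1 u] x₀).NeBot := mem_closure_iff_nhdsWithin_neBot.1 hcl
  have h1 : ∀ᶠ x in 𝓝[Omega 1 u] x₀, P x :=
    hP.filter_mono (nhdsWithin_mono _ ((Omega_subset 1 u).trans subset_union_left))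
  have h2 : ∀ᶠ x in 𝓝[Omega 1 u] x₀, dist x x₀ < η :=
    mem_nhdsWithin_of_mem_nhds (ball_mem_nhds x₀ hη)
  obtain ⟨x, ⟨hx1, hx2⟩, hx3⟩ := ((h1.and h2).and self_mem_nhdsWithin).exists
  exact ⟨x, hx3, hx2, hx1⟩

end HalfBallObstacle

/-! ### Non-degeneracy with an explicit constant -/

open HalfBallObstacle in
theorem mainTheorem4 (n : ℕ) [NeZero n] :
    ∃ C C' : ℝ, 0 < C' ∧ C' ≤ C ∧
      ∀ (M : ℝ) (u : E n → ℝ), LocalSolutionAtZero 1 M u →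
        ∀ x₀ ∈ closure (Omega 1 u) ∩ Metric.ball 0 (1 / 2),
          (0 ≤ u x₀ →
            (x₀ 0 = 0 → ∃ c : ℝ, 0 ≤ c ∧ HasNormalDeriv u c x₀) →
            ∀ r : ℝ, 0 < r → r < Metric.infDist x₀ (frontier (Metric.ball (0 : E n) 1)) →
              u x₀ + C * r ^ 2 ≤ sSup (u '' halfBall x₀ r)) ∧
          (u x₀ < 0 →
            ∀ r : ℝ, 0 < r → Metric.ball x₀ r ⊆ halfBall 0 1 →
              u x₀ + C' * r ^ 2 ≤ sSup (u '' halfBall x₀ r)) := by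
  have hn : (0 : ℝ) < n := Nat.cast_pos.2 (Nat.pos_of_ne_zero (NeZero.ne n))
  -- Any positive constant below `1/(2n)` would do, and one serves both cases.
  set C : ℝ := 1 / (4 * n)
  have hC : 0 < C := by positivity
  have hCn : C * (2 * n) < 1 := by
    have : C * (2 * n) = 1 / 2 := by simp only [C]; field_simp; norm_num
    linarith
  refine ⟨C, C, hC, le_rfl, ?_⟩
  rintro M u ⟨hu, -⟩ x₀ ⟨hcl, hhalf⟩
  have hx₀ball : x₀ ∈ ball (0 : E n) 1 := ball_subset_ball (by norm_num) hhalf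
  have hnn : 0 ≤ x₀ 0 :=
    closure_minimal (t := {x : E n | 0 ≤ x 0}) (fun x hx => (show 0 < x 0 from hx.1.1).le)
      (isClosed_le continuous_const continuous_coord) hcl
  have hev : ∀ η > 0, x₀ ∈ halfBall 0 1 →
      ∀ᶠ x in nhdsWithin x₀ (halfBall 0 1 ∪ flatBall n 1), u x₀ - η < u x := fun η hη hx =>
    (hu.continuousOn x₀ (Or.inl hx)).eventually (lt_mem_nhds (by linarith))
  refine ⟨fun hpos hder r hr hrd => ?_, fun hneg r hr hball => ?_⟩
  · have hball := ball_subset_of_lt_infDist_frontier hx₀ball hrd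
    refine hu.le_sSup_image hr hC hCn hball fun η hη => ?_
    rcases hnn.eq_or_lt with h0 | h0
    · obtain ⟨c, hc, hd⟩ := hder h0.symm
      have hflat : x₀ ∈ flatBall n 1 := ⟨h0.symm, hx₀ball⟩
      obtain ⟨x₁, hx₁, hdist, hux⟩ := hu.exists_mem_Omega_nonneg hflat hcl hc hd hη
      refine ⟨x₁, hx₁, hdist, by rw [hu.eq_zero x₀ hflat]; linarith, fun x _ hx0 => ?_⟩
      have hne : x ≠ x₁ := fun h => (show 0 < x₁ 0 from hx₁.1.1).ne' (h ▸ hx0)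
      have := mul_pos hC (pow_pos (dist_pos.2 hne) 2)
      linarith
    · have hxH : x₀ ∈ halfBall 0 1 := ⟨h0, hx₀ball⟩
      -- Points of `Π` are at distance at least the height of `x₁` from `x₁`, so this inequality at
      -- `x₁` rules out a maximum on `Π`. It holds near `x₀`, where `u(x₀) ≥ 0` and the height is
      -- positive.
      have hev2 : ∀ᶠ x in nhdsWithin x₀ (halfBall 0 1 ∪ flatBall n 1),
          0 < u x + C * x 0 ^ 2 := by
        have hcont : ContinuousWithinAt (fun x : E n => u x + C * x 0 ^ 2)
            (halfBall 0 1 ∪ flatBall n 1) x₀ :=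
          (hu.continuousOn x₀ (Or.inl hxH)).add
            (Continuous.continuousWithinAt (by fun_prop))
        exact hcont.eventually (lt_mem_nhds (by positivity))
      obtain ⟨x₁, hx₁, hdist, h1, h2⟩ :=
        exists_mem_Omega_of_eventually hcl ((hev η hη hxH).and hev2) hη
      refine ⟨x₁, hx₁, hdist, h1, fun x _ hx0 => ?_⟩
      have h3 := abs_coord_sub_le_dist x x₁
      rw [hx0, zero_sub, abs_neg] at h3
      have h4 : x₁ 0 ^ 2 ≤ dist x x₁ ^ 2 := by rw [← sq_abs]; gcongr
      have := mul_le_mul_of_nonneg_left h4 hC.le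
      linarith
  · refine hu.le_sSup_image hr hC hCn (hball.trans inter_subset_right) fun η hη => ?_
    obtain ⟨x₁, hx₁, hdist, h1⟩ :=
      exists_mem_Omega_of_eventually hcl (hev η hη (hball (mem_ball_self hr))) hη
    -- The ball misses `Π`, so the sign of `u` plays no role.
    exact ⟨x₁, hx₁, hdist, h1, fun x hx hx0 => absurd hx0 (hball hx).1.ne'⟩
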